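/- **Theorem (soundness and completeness of $\mathrm{TFS}^q$).** *Syntax.* A typed signature consists of basic types, function symbols $F:\sigma_1,\dots,\sigma_n\to\tau$ and predicate symbols $R:\sigma_1,\dots,\sigma_n$, where types are generated from the basic types by $1$ and $\sigma\times\tau$ (cartesian type theory). Terms in a context $\Phi=(x_1:\sigma_1,\dots,x_n:\sigma_n)$ are built from the variables by function symbols, $*:1$, pairing $\langle s,t\rangle$ and the projections $\pi_1,\pi_2$; equality of terms is the congruence generated by $\pi_1\langle s,t\rangle=s$, $\pi_2\langle s,t\rangle=t$, $\langle\pi_1 t,\pi_2 t\rangle=t$, and $t=*$ for $t:1$. Formulas in context are built from literals $R(\vec t)$, $R^\perp(\vec t)$ by $\top,\bot,\wedge,\vee$ and $\forall x{:}\sigma$, $\exists x{:}\sigma$; the negation $A^\perp$ is defined by the De Morgan laws and is involutive. A sequent $\Gamma\vdash\Delta\ [\Phi]$ consists of finite lists $\Gamma,\Delta$ of formulas in context $\Phi$. *Calculus.* $\mathrm{TFS}^q$ is the typed first-order form of Faggian–Sambin's sequent calculus for orthologic. Its rules are: identity $A\vdash A$; the two cuts $$\frac{\Gamma'\vdash A\quad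 A,\Gamma\vdash\Delta}{\Gamma',\Gamma\vdash\Delta},\qquad \frac{\Gamma\vdash A,\Delta\quad A\vdash\Delta'}{\Gamma\vdash\Delta',\Delta};$$ exchange, weakening and contraction on both sides; transfer $$\frac{\Gamma\vdash\Delta}{\Gamma,\Delta^\perp\vdash},\qquad \frac{\Gamma\vdash\Delta}{\vdash\Gamma^\perp,\Delta};$$ the axioms $\Gamma\vdash\top$ and $\bot\vdash\Delta$; the rules for $\wedge,\vee,\forall,\exists$ with no side formulas next to the principal and active formulas, $$\frac{A\vdash\Delta}{A\wedge B\vdash\Delta},\quad \frac{B\vdash\Delta}{A\wedge B\vdash\Delta},\quad \frac{\Gamma\vdash A\quad \Gamma\vdash B}{\Gamma\vdash A\wedge B},\quad \frac{A\vdash\Delta\quad B\vdash\Delta}{A\vee B\vdash\Delta},\quad \frac{\Gamma\vdash A}{\Gamma\vdash A\vee B},\quad \frac{\Gamma\vdash B}{\Gamma\vdash A\vee B},$$ $$\frac{A[t/x]\vdash\Delta\ [\Phi]}{\forall x\,A\vdash\Delta\ [\Phi]},\quad \frac{\Gamma\vdash A\ [\Phi,x{:}\sigma]}{\Gamma\vdash\forall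 x\,A\ [\Phi]},\quad \frac{A\vdash\Delta\ [\Phi,x{:}\sigma]}{\exists x\,A\vdash\Delta\ [\Phi]},\quad \frac{\Gamma\vdash A[t/x]\ [\Phi]}{\Gamma\vdash\exists x\,A\ [\Phi]}$$ (where $\Gamma,\Delta$ in the second and third rule are formulas in context $\Phi$, and $t:\sigma$ is a term in context $\Phi$); substitution of terms for the variables of a whole sequent; and $A[t/x]\vdash A[t'/x]$ whenever $t=t'$ in the type theory. *Semantics.* $\mathbf{QL}$ is the category of ortholattices and their homomorphisms. A $\mathbf{QL}$-hyperdoctrine is a functor $P:\mathbf C^{\mathrm{op}}\to\mathbf{QL}$, with $\mathbf C$ a category with finite products, such that for every projection $\pi:X\times Y\to Y$ the map $P(\pi)$ has a right adjoint $\forall_\pi$ and a left adjoint $\exists_\pi$, both satisfying the Beck–Chevalley condition ($P(f)\circ\forall_\pi=\forall_{\pi'}\circ P(X\times f)$ and $P(f)\circ\exists_\pi=\exists_{\pi'}\circ P(X\times f)$ for $f:Z\to Y$ and the projection $\pi':X\times Z\to Z$). An interpretation of a signature in $P$ assigns objects of $\mathbf C$ to basic types, arrows to function symbols and elements of the appropriate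 fibres to predicate symbols. It extends to types and contexts by finite products, to terms in the usual way, and to formulas in context $\Phi$ as elements of $P([\![\Phi]\!])$: substitution is pullback, the connectives and ${}^\perp$ on literals are the ortholattice operations, and quantifiers are $\forall_\pi,\exists_\pi$. A sequent $\Gamma\vdash\Delta\ [\Phi]$ is valid in the interpretation if $\bigwedge_{A\in\Gamma}[\![A]\!]\le\bigvee_{B\in\Delta}[\![B]\!]$ in $P([\![\Phi]\!])$. *Claim.* For every typed signature and every sequent $\Gamma\vdash\Delta\ [\Phi]$ over it: 1. (Soundness) if $\Gamma\vdash\Delta\ [\Phi]$ is derivable in $\mathrm{TFS}^q$, then it is valid in every interpretation in every $\mathbf{QL}$-hyperdoctrine; 2. (Completeness) if $\Gamma\vdash\Delta\ [\Phi]$ is valid in every interpretation in every $\mathbf{QL}$-hyperdoctrine, then it is derivable in $\mathrm{TFS}^q$. (Soundness holds for hyperdoctrines of any size; for completeness, validity in hyperdoctrines whose base category and fibres live in the universe of the signature suffices.) -/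

import Mathlib

open CategoryTheory MonoidalCategory CartesianMonoidalCategory

universe u v w x

/-! ### Ortholattices and the category `QL` -/

/-- An ortholattice: a bounded lattice with an order-reversing involutive complementation. -/
class Ortholattice (α : Type u) extends Lattice α, BoundedOrder α, Compl α where
  compl_compl_eq : ∀ a : α, aᶜᶜ = a
  compl_anti : ∀ a b : α, a ≤ b → bᶜ ≤ aᶜ
  inf_compl_eq : ∀ a : α, a ⊓ aᶜ = ⊥
  sup_compl_eq : ∀ a : α, a ⊔ aᶜ = ⊤

/-- Homomorphisms of ortholattices: maps preserving all operations. -/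
structure OrthoHom (α β : Type u) [Ortholattice α] [Ortholattice β] extends
    BoundedLatticeHom α β where
  map_compl' : ∀ a : α, toFun aᶜ = (toFun a)ᶜ

namespace OrthoHom

variable {α β γ : Type u} [Ortholattice α] [Ortholattice β] [Ortholattice γ]

instance : FunLike (OrthoHom α β) α β where
  coe f := f.toFun
  coe_injective f g h := by
    obtain ⟨f, _⟩ := f
    obtain ⟨g, _⟩ := g
    have : f = g := DFunLike.coe_injective h
    subst this
    rfl

/-- The identity homomorphism. -/
def id (α : Type u) [Ortholattice α] : OrthoHom α α where
  toBoundedLatticeHom := BoundedLatticeHom.id α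
  map_compl' _ := rfl

/-- Composition of homomorphisms. -/
def comp (g : OrthoHom β γ) (f : OrthoHom α β) : OrthoHom α γ where
  toBoundedLatticeHom := g.toBoundedLatticeHom.comp f.toBoundedLatticeHom
  map_compl' a := (congrArg g.toFun (f.map_compl' a)).trans (g.map_compl' _)

end OrthoHom

/-- The objects of the category of ortholattices. -/
structure QL : Type (u + 1) where
  carrier : Type u
  [str : Ortholattice carrier]

namespace QL

instance : CoeSort QL.{u} (Type u) := ⟨QL.carrier⟩

attribute [instance] QL.str

/-- Morphisms of `QL`, wrapping homomorphisms of ortholattices. -/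
structure Hom (A B : QL.{u}) where
  hom' : OrthoHom A B

instance : Category QL.{u} where
  Hom := Hom
  id A := ⟨OrthoHom.id A⟩
  comp f g := ⟨g.hom'.comp f.hom'⟩

instance : ConcreteCategory QL.{u} (fun A B => OrthoHom A B) where
  hom := Hom.hom'
  ofHom := Hom.mk

end QL

/-! ### Quantified `QL`-hyperdoctrines -/

/-- A `QL`-hyperdoctrine over a category `C` with finite products: a presheaf of ortholattices
such that pullback along every projection `π : X ⊗ Y ⟶ Y` has a right adjoint `all X Y` and a left
adjoint `ex X Y`, both satisfying the Beck-Chevalley condition. -/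
structure QLHyperdoctrine (C : Type u) [Category.{v} C] [CartesianMonoidalCategory C] where
  /-- The presheaf. -/
  P : Cᵒᵖ ⥤ QL.{w}
  /-- The universal quantifier along the projection `X ⊗ Y ⟶ Y`. -/
  all : ∀ X Y : C, P.obj (.op (X ⊗ Y)) → P.obj (.op Y)
  all_adj : ∀ X Y : C,
    GaloisConnection (fun a : P.obj (.op Y) => P.map (snd X Y).op a) (all X Y)
  all_beckChevalley : ∀ (X : C) {Y Z : C} (f : Z ⟶ Y) (a : P.obj (.op (X ⊗ Y))),
    P.map f.op (all X Y a) = all X Z (P.map (X ◁ f).op a)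
  /-- The existential quantifier along the projection `X ⊗ Y ⟶ Y`. -/
  ex : ∀ X Y : C, P.obj (.op (X ⊗ Y)) → P.obj (.op Y)
  ex_adj : ∀ X Y : C,
    GaloisConnection (ex X Y) (fun a : P.obj (.op Y) => P.map (snd X Y).op a)
  ex_beckChevalley : ∀ (X : C) {Y Z : C} (f : Z ⟶ Y) (a : P.obj (.op (X ⊗ Y))),
    P.map f.op (ex X Y a) = ex X Z (P.map (X ◁ f).op a)

/-! ### Syntax: cartesian type theory and formulas -/

namespace TFSq

/-- Types: basic types, the unit type and binary product types. -/
inductive Ty (S : Type u) : Type u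
  | base : S → Ty S
  | unit : Ty S
  | prod : Ty S → Ty S → Ty S

/-- A typed signature: basic types, typed function symbols, typed predicate symbols. -/
structure Signature : Type (u + 1) where
  /-- Basic types. -/
  Srt : Type u
  /-- Function symbols. -/
  Fn : Type u
  /-- The types of the arguments of a function symbol. -/
  dom : Fn → List (Ty Srt)
  /-- The type of the value of a function symbol. -/
  cod : Fn → Ty Srt
  /-- Predicate symbols. -/
  Rel : Type u
  /-- The types of the arguments of a predicate symbol. -/
  ar : Rel → List (Ty Srt)

/-- A context `x₁ : σ₁, …, xₙ : σₙ`; variables are positions in the list (de Bruijn indices). -/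
abbrev Ctx (Sg : Signature.{u}) : Type u := List (Ty Sg.Srt)

/-- `Var Φ σ`: the variables of type `σ` in the context `Φ`. -/
inductive Var {S : Type u} : List (Ty S) → Ty S → Type u
  | zero {Φ : List (Ty S)} {σ : Ty S} : Var (σ :: Φ) σ
  | succ {Φ : List (Ty S)} {σ τ : Ty S} : Var Φ σ → Var (τ :: Φ) σ

variable {Sg : Signature.{u}}

/-- `Term Sg Φ σ`: the terms of type `σ` in the context `Φ`. -/
inductive Term (Sg : Signature.{u}) (Φ : Ctx Sg) : Ty Sg.Srt → Type u
  | var {σ : Ty Sg.Srt} : Var Φ σ → Term Sg Φ σ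
  | app (f : Sg.Fn) : (∀ τ, Var (Sg.dom f) τ → Term Sg Φ τ) → Term Sg Φ (Sg.cod f)
  | star : Term Sg Φ Ty.unit
  | pair {σ τ : Ty Sg.Srt} : Term Sg Φ σ → Term Sg Φ τ → Term Sg Φ (Ty.prod σ τ)
  | fst {σ τ : Ty Sg.Srt} : Term Sg Φ (Ty.prod σ τ) → Term Sg Φ σ
  | snd {σ τ : Ty Sg.Srt} : Term Sg Φ (Ty.prod σ τ) → Term Sg Φ τ

/-- `Subst Ψ Φ`: tuples of terms in context `Φ`, one for each variable of `Ψ`. -/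
abbrev Subst (Ψ Φ : Ctx Sg) : Type u := ∀ τ, Var Ψ τ → Term Sg Φ τ

/-- Substitution in terms. -/
def Term.subst {Ψ Φ : Ctx Sg} (s : Subst Ψ Φ) {σ : Ty Sg.Srt} : Term Sg Ψ σ → Term Sg Φ σ
  | .var y => s _ y
  | .app f ts => .app f (fun τ y => (ts τ y).subst s)
  | .star => .star
  | .pair a b => .pair (a.subst s) (b.subst s)
  | .fst a => .fst (a.subst s)
  | .snd a => .snd (a.subst s)

/-- Weakening by one fresh variable, as a substitution. -/
def Subst.wk (σ : Ty Sg.Srt) (Φ : Ctx Sg) : Subst Φ (σ :: Φ) := fun _ y => .var y.succ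

/-- Extending a substitution by a term for the last variable. -/
def Subst.cons {Ψ Φ : Ctx Sg} {σ : Ty Sg.Srt} (t : Term Sg Φ σ) (s : Subst Ψ Φ) :
    Subst (σ :: Ψ) Φ
  | _, .zero => t
  | _, .succ y => s _ y

/-- Passing under a binder. -/
def Subst.lift {Ψ Φ : Ctx Sg} (σ : Ty Sg.Srt) (s : Subst Ψ Φ) : Subst (σ :: Ψ) (σ :: Φ) :=
  Subst.cons (.var .zero) (fun _ y => (s _ y).subst (Subst.wk σ Φ))

/-- Substituting a single term for the last variable. -/
def Subst.single {Φ : Ctx Sg} {σ : Ty Sg.Srt} (t : Term Sg Φ σ) : Subst (σ :: Φ) Φ :=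
  Subst.cons t (fun _ y => .var y)

/-- The equations between terms that hold in cartesian type theory. -/
inductive TermEq {Φ : Ctx Sg} : {σ : Ty Sg.Srt} → Term Sg Φ σ → Term Sg Φ σ → Prop
  | refl {σ} (a : Term Sg Φ σ) : TermEq a a
  | symm {σ} {a b : Term Sg Φ σ} : TermEq a b → TermEq b a
  | trans {σ} {a b c : Term Sg Φ σ} : TermEq a b → TermEq b c → TermEq a c
  | app (f : Sg.Fn) {ts ts' : Subst (Sg.dom f) Φ} :
      (∀ τ y, TermEq (ts τ y) (ts' τ y)) → TermEq (.app f ts) (.app f ts')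
  | pair {σ τ} {a a' : Term Sg Φ σ} {b b' : Term Sg Φ τ} :
      TermEq a a' → TermEq b b' → TermEq (.pair a b) (.pair a' b')
  | fst {σ τ} {a a' : Term Sg Φ (.prod σ τ)} : TermEq a a' → TermEq (.fst a) (.fst a')
  | snd {σ τ} {a a' : Term Sg Φ (.prod σ τ)} : TermEq a a' → TermEq (.snd a) (.snd a')
  | fst_pair {σ τ} (a : Term Sg Φ σ) (b : Term Sg Φ τ) : TermEq (.fst (.pair a b)) a
  | snd_pair {σ τ} (a : Term Sg Φ σ) (b : Term Sg Φ τ) : TermEq (.snd (.pair a b)) b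
  | pair_eta {σ τ} (a : Term Sg Φ (.prod σ τ)) : TermEq (.pair (.fst a) (.snd a)) a
  | unit_eta (a : Term Sg Φ .unit) : TermEq a .star

/-- Formulas in context: built from positive and negative literals `R(t⃗)`, `R^⊥(t⃗)` by
truth, falsity, conjunction, disjunction and the two typed quantifiers. -/
inductive Formula (Sg : Signature.{u}) : Ctx Sg → Type u
  | atom {Φ : Ctx Sg} (R : Sg.Rel) : (∀ τ, Var (Sg.ar R) τ → Term Sg Φ τ) → Formula Sg Φ
  | natom {Φ : Ctx Sg} (R : Sg.Rel) : (∀ τ, Var (Sg.ar R) τ → Term Sg Φ τ) → Formula Sg Φ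
  | top {Φ : Ctx Sg} : Formula Sg Φ
  | bot {Φ : Ctx Sg} : Formula Sg Φ
  | and {Φ : Ctx Sg} : Formula Sg Φ → Formula Sg Φ → Formula Sg Φ
  | or {Φ : Ctx Sg} : Formula Sg Φ → Formula Sg Φ → Formula Sg Φ
  | all {Φ : Ctx Sg} (σ : Ty Sg.Srt) : Formula Sg (σ :: Φ) → Formula Sg Φ
  | ex {Φ : Ctx Sg} (σ : Ty Sg.Srt) : Formula Sg (σ :: Φ) → Formula Sg Φ

/-- The (defined, involutive) negation `A^⊥`. -/
def Formula.neg {Φ : Ctx Sg} : Formula Sg Φ → Formula Sg Φ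
  | .atom R ts => .natom R ts
  | .natom R ts => .atom R ts
  | .top => .bot
  | .bot => .top
  | .and A B => .or A.neg B.neg
  | .or A B => .and A.neg B.neg
  | .all σ A => .ex σ A.neg
  | .ex σ A => .all σ A.neg

/-- Capture-avoiding substitution in formulas. -/
def Formula.subst : {Ψ Φ : Ctx Sg} → Subst Ψ Φ → Formula Sg Ψ → Formula Sg Φ
  | _, _, s, .atom R ts => .atom R (fun τ y => (ts τ y).subst s)
  | _, _, s, .natom R ts => .natom R (fun τ y => (ts τ y).subst s)
  | _, _, _, .top => .top
  | _, _, _, .bot => .bot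
  | _, _, s, .and A B => .and (A.subst s) (B.subst s)
  | _, _, s, .or A B => .or (A.subst s) (B.subst s)
  | _, _, s, .all σ A => .all σ (A.subst (s.lift σ))
  | _, _, s, .ex σ A => .ex σ (A.subst (s.lift σ))

/-- Weakening a formula by a fresh variable. -/
def Formula.wk {Φ : Ctx Sg} (σ : Ty Sg.Srt) (A : Formula Sg Φ) : Formula Sg (σ :: Φ) :=
  A.subst (Subst.wk σ Φ)

/-- The instance `A[t/x]` of a formula at a term. -/
def Formula.inst {Φ : Ctx Sg} {σ : Ty Sg.Srt} (A : Formula Sg (σ :: Φ)) (t : Term Sg Φ σ) :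
    Formula Sg Φ :=
  A.subst (Subst.single t)

/-! ### The sequent calculus -/

/-- `Derivable Γ Δ` for lists `Γ`, `Δ` of formulas in context `Φ`: the sequent `Γ ⊢ Δ [Φ]` is
derivable. In every logical rule the principal formula and the active formulas stand without side
formulas on their own side of the sequent. -/
inductive Derivable : {Φ : Ctx Sg} → List (Formula Sg Φ) → List (Formula Sg Φ) → Prop
  -- identity and cut
  | id {Φ : Ctx Sg} (A : Formula Sg Φ) : Derivable [A] [A]
  | cutL {Φ : Ctx Sg} {Γ Γ' Δ : List (Formula Sg Φ)} {A : Formula Sg Φ} :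
      Derivable Γ' [A] → Derivable (A :: Γ) Δ → Derivable (Γ' ++ Γ) Δ
  | cutR {Φ : Ctx Sg} {Γ Δ Δ' : List (Formula Sg Φ)} {A : Formula Sg Φ} :
      Derivable Γ (A :: Δ) → Derivable [A] Δ' → Derivable Γ (Δ' ++ Δ)
  -- exchange, weakening, contraction
  | exchL {Φ : Ctx Sg} {Γ Γ' Δ : List (Formula Sg Φ)} :
      Γ.Perm Γ' → Derivable Γ Δ → Derivable Γ' Δ
  | exchR {Φ : Ctx Sg} {Γ Δ Δ' : List (Formula Sg Φ)} :
      Δ.Perm Δ' → Derivable Γ Δ → Derivable Γ Δ'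
  | weakL {Φ : Ctx Sg} {Γ Δ : List (Formula Sg Φ)} (A : Formula Sg Φ) :
      Derivable Γ Δ → Derivable (A :: Γ) Δ
  | weakR {Φ : Ctx Sg} {Γ Δ : List (Formula Sg Φ)} (A : Formula Sg Φ) :
      Derivable Γ Δ → Derivable Γ (A :: Δ)
  | contrL {Φ : Ctx Sg} {Γ Δ : List (Formula Sg Φ)} {A : Formula Sg Φ} :
      Derivable (A :: A :: Γ) Δ → Derivable (A :: Γ) Δ
  | contrR {Φ : Ctx Sg} {Γ Δ : List (Formula Sg Φ)} {A : Formula Sg Φ} :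
      Derivable Γ (A :: A :: Δ) → Derivable Γ (A :: Δ)
  -- transfer to the other side with negation
  | trL {Φ : Ctx Sg} {Γ Δ : List (Formula Sg Φ)} :
      Derivable Γ Δ → Derivable (Γ ++ Δ.map Formula.neg) []
  | trR {Φ : Ctx Sg} {Γ Δ : List (Formula Sg Φ)} :
      Derivable Γ Δ → Derivable [] (Γ.map Formula.neg ++ Δ)
  -- connectives
  | topR {Φ : Ctx Sg} (Γ : List (Formula Sg Φ)) : Derivable Γ [.top]
  | botL {Φ : Ctx Sg} (Δ : List (Formula Sg Φ)) : Derivable [.bot] Δ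
  | andL₁ {Φ : Ctx Sg} {Δ : List (Formula Sg Φ)} {A : Formula Sg Φ} (B : Formula Sg Φ) :
      Derivable [A] Δ → Derivable [.and A B] Δ
  | andL₂ {Φ : Ctx Sg} {Δ : List (Formula Sg Φ)} {B : Formula Sg Φ} (A : Formula Sg Φ) :
      Derivable [B] Δ → Derivable [.and A B] Δ
  | andR {Φ : Ctx Sg} {Γ : List (Formula Sg Φ)} {A B : Formula Sg Φ} :
      Derivable Γ [A] → Derivable Γ [B] → Derivable Γ [.and A B]
  | orL {Φ : Ctx Sg} {Δ : List (Formula Sg Φ)} {A B : Formula Sg Φ} :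
      Derivable [A] Δ → Derivable [B] Δ → Derivable [.or A B] Δ
  | orR₁ {Φ : Ctx Sg} {Γ : List (Formula Sg Φ)} {A : Formula Sg Φ} (B : Formula Sg Φ) :
      Derivable Γ [A] → Derivable Γ [.or A B]
  | orR₂ {Φ : Ctx Sg} {Γ : List (Formula Sg Φ)} {B : Formula Sg Φ} (A : Formula Sg Φ) :
      Derivable Γ [B] → Derivable Γ [.or A B]
  -- quantifiers
  | allL {Φ : Ctx Sg} {σ : Ty Sg.Srt} {Δ : List (Formula Sg Φ)} {A : Formula Sg (σ :: Φ)}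
      (t : Term Sg Φ σ) : Derivable [A.inst t] Δ → Derivable [.all σ A] Δ
  | allR {Φ : Ctx Sg} {σ : Ty Sg.Srt} {Γ : List (Formula Sg Φ)} {A : Formula Sg (σ :: Φ)} :
      Derivable (Γ.map (Formula.wk σ)) [A] → Derivable Γ [.all σ A]
  | exL {Φ : Ctx Sg} {σ : Ty Sg.Srt} {Δ : List (Formula Sg Φ)} {A : Formula Sg (σ :: Φ)} :
      Derivable [A] (Δ.map (Formula.wk σ)) → Derivable [.ex σ A] Δ
  | exR {Φ : Ctx Sg} {σ : Ty Sg.Srt} {Γ : List (Formula Sg Φ)} {A : Formula Sg (σ :: Φ)}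
      (t : Term Sg Φ σ) : Derivable Γ [A.inst t] → Derivable Γ [.ex σ A]
  -- substitution of terms for variables, and replacement of equal terms
  | subst {Ψ Φ : Ctx Sg} {Γ Δ : List (Formula Sg Ψ)} (s : Subst Ψ Φ) :
      Derivable Γ Δ → Derivable (Γ.map (Formula.subst s)) (Δ.map (Formula.subst s))
  | conv {Φ : Ctx Sg} {σ : Ty Sg.Srt} {t t' : Term Sg Φ σ} (A : Formula Sg (σ :: Φ)) :
      TermEq t t' → Derivable [A.inst t] [A.inst t']

/-! ### Interpretations in hyperdoctrines -/

section Semantics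

variable {C : Type v} [Category.{w} C] [CartesianMonoidalCategory C]

/-- The object interpreting a type. -/
@[reducible] def evalTy {S : Type u} (b : S → C) : Ty S → C
  | .base s => b s
  | .unit => 𝟙_ C
  | .prod σ τ => evalTy b σ ⊗ evalTy b τ

/-- The object interpreting a context: the product of the objects interpreting its types. -/
@[reducible] def evalCtx {S : Type u} (b : S → C) : List (Ty S) → C
  | [] => 𝟙_ C
  | σ :: Φ => evalTy b σ ⊗ evalCtx b Φ

/-- The projection interpreting a variable. -/
def evalVar {S : Type u} (b : S → C) : {Φ : List (Ty S)} → {σ : Ty S} → Var Φ σ →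
    (evalCtx b Φ ⟶ evalTy b σ)
  | _, _, .zero => fst _ _
  | _, _, .succ y => snd _ _ ≫ evalVar b y

/-- The morphism into the object interpreting `Ψ` with given components. -/
def tuple {S : Type u} (b : S → C) {X : C} :
    (Ψ : List (Ty S)) → (∀ τ, Var Ψ τ → (X ⟶ evalTy b τ)) → (X ⟶ evalCtx b Ψ)
  | [], _ => toUnit X
  | σ :: Ψ, g => lift (g σ .zero) (tuple b Ψ (fun τ y => g τ y.succ))

/-- An interpretation of a signature in a hyperdoctrine: an object for each basic type, a morphism
for each function symbol, an element of the appropriate fibre for each predicate symbol. -/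
structure Interp (Sg : Signature.{u}) (H : QLHyperdoctrine.{v, w, x} C) where
  /-- Interpretation of basic types. -/
  srt : Sg.Srt → C
  /-- Interpretation of function symbols. -/
  fn : ∀ f : Sg.Fn, evalCtx srt (Sg.dom f) ⟶ evalTy srt (Sg.cod f)
  /-- Interpretation of predicate symbols. -/
  rel : ∀ R : Sg.Rel, H.P.obj (.op (evalCtx srt (Sg.ar R)))

namespace Interp

variable {H : QLHyperdoctrine.{v, w, x} C} (I : Interp Sg H)

/-- The interpretation of a term in context. -/
def term {Φ : Ctx Sg} {σ : Ty Sg.Srt} : Term Sg Φ σ → (evalCtx I.srt Φ ⟶ evalTy I.srt σ)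
  | .var y => evalVar I.srt y
  | .app f ts => tuple I.srt (Sg.dom f) (fun τ y => term (ts τ y)) ≫ I.fn f
  | .star => toUnit _
  | .pair a b => lift (term a) (term b)
  | .fst a => term a ≫ CartesianMonoidalCategory.fst _ _
  | .snd a => term a ≫ CartesianMonoidalCategory.snd _ _

/-- The interpretation of a formula in context, an element of the fibre over the context. -/
def formula : {Φ : Ctx Sg} → Formula Sg Φ → H.P.obj (.op (evalCtx I.srt Φ))
  | _, .atom R ts => H.P.map (tuple I.srt (Sg.ar R) (fun τ y => I.term (ts τ y))).op (I.rel R)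
  | _, .natom R ts =>
      (H.P.map (tuple I.srt (Sg.ar R) (fun τ y => I.term (ts τ y))).op (I.rel R))ᶜ
  | _, .top => ⊤
  | _, .bot => ⊥
  | _, .and A B => formula A ⊓ formula B
  | _, .or A B => formula A ⊔ formula B
  | Φ, .all σ A => H.all (evalTy I.srt σ) (evalCtx I.srt Φ) (formula A)
  | Φ, .ex σ A => H.ex (evalTy I.srt σ) (evalCtx I.srt Φ) (formula A)

/-- Validity of `Γ ⊢ Δ [Φ]`: the meet of the interpretations of the formulas in `Γ` is below the
join of the interpretations of those in `Δ` (empty meet `⊤`, empty join `⊥`). -/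
def Valid {Φ : Ctx Sg} (Γ Δ : List (Formula Sg Φ)) : Prop :=
  (Γ.map I.formula).foldr (· ⊓ ·) ⊤ ≤ (Δ.map I.formula).foldr (· ⊔ ·) ⊥

end Interp

end Semantics

end TFSq

/-!
Soundness is an induction on derivations. Substitution is interpreted by pullback
(`TFSq.Interp.formula_subst`, which at the quantifiers is the Beck-Chevalley condition), and the
defined negation is interpreted by the orthocomplement (`TFSq.Interp.formula_neg`): pullbacks
preserve complements, so by uniqueness of adjoints `∃` is the De Morgan dual of `∀` in every fibre.

Completeness is by a term model. Its base category has the types as objects, and the terms of type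
`τ` in one variable of type `σ`, up to provable equality, as arrows `σ ⟶ τ`; the fibre over `σ` is
the Lindenbaum algebra of the formulas in one variable of type `σ`. Two facts about the calculus are
needed beyond the obvious ones.

* Contraposition, `A ⊢ B` implies `B^⊥ ⊢ A^⊥`, makes the complement well defined and antitone
  on the Lindenbaum algebra. The transfer rules do not give it, but the calculus is self-dual
  (`TFSq.Derivable.contrapose`).
* Substitutions that are pointwise equal in the type theory give interderivable formulas
  (`TFSq.Derivable.subst_conv`), so that pullback is well defined on arrows.

In the generic interpretation a formula in context `Φ` denotes its own class, with the variables of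
`Φ` read as the projections from a tuple (`TFSq.genericInterp_formula_heq`). A type equals the object
interpreting it only propositionally, by induction on the type, so this comparison is a
heterogeneous equality. Substituting the tuple of variables of `Φ` back recovers the formula, and
`⋀ Γ ⊢ ⋁ Δ` yields `Γ ⊢ Δ` by cuts.
-/

/-! ### De Morgan duality in ortholattices and hyperdoctrines -/

namespace OrthoHom

variable {α β : Type u} [Ortholattice α] [Ortholattice β]

instance : BoundedLatticeHomClass (OrthoHom α β) α β where
  map_sup f := f.map_sup'
  map_inf f := f.map_inf'
  map_top f := f.map_top'
  map_bot f := f.map_bot'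

theorem map_compl (f : OrthoHom α β) (a : α) : f aᶜ = (f a)ᶜ := f.map_compl' a

end OrthoHom

namespace Ortholattice

variable {α : Type u} [Ortholattice α]

theorem compl_le_iff {a b : α} : aᶜ ≤ b ↔ bᶜ ≤ a :=
  ⟨fun h => compl_compl_eq a ▸ compl_anti _ _ h, fun h => compl_compl_eq b ▸ compl_anti _ _ h⟩

theorem le_compl_iff {a b : α} : a ≤ bᶜ ↔ b ≤ aᶜ :=
  ⟨fun h => compl_compl_eq b ▸ compl_anti _ _ h, fun h => compl_compl_eq a ▸ compl_anti _ _ h⟩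

theorem compl_sup (a b : α) : (a ⊔ b)ᶜ = aᶜ ⊓ bᶜ := by
  apply le_antisymm
  · exact le_inf (compl_anti _ _ le_sup_left) (compl_anti _ _ le_sup_right)
  · exact le_compl_iff.1 (sup_le (le_compl_iff.1 inf_le_left) (le_compl_iff.1 inf_le_right))

theorem compl_inf (a b : α) : (a ⊓ b)ᶜ = aᶜ ⊔ bᶜ := by
  rw [← compl_compl_eq (aᶜ ⊔ bᶜ), compl_sup, compl_compl_eq, compl_compl_eq]

theorem compl_top : (⊤ : α)ᶜ = ⊥ := by
  simpa using inf_compl_eq (⊤ : α)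

theorem compl_bot : (⊥ : α)ᶜ = ⊤ := by
  simpa using sup_compl_eq (⊥ : α)

end Ortholattice

namespace QLHyperdoctrine

variable {C : Type v} [Category.{w} C] [CartesianMonoidalCategory C]
  (H : QLHyperdoctrine.{v, w, x} C)

theorem map_comp_apply {X Y Z : C} (f : X ⟶ Y) (g : Y ⟶ Z) (a : H.P.obj (.op Z)) :
    H.P.map (f ≫ g).op a = H.P.map f.op (H.P.map g.op a) := by
  rw [op_comp, H.P.map_comp, ConcreteCategory.comp_apply]

theorem map_id_apply {X : C} (a : H.P.obj (.op X)) : H.P.map (𝟙 X).op a = a := by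
  rw [op_id, H.P.map_id, ConcreteCategory.id_apply]

theorem map_snd_le_iff {X Y : C} {a : H.P.obj (.op Y)} {b : H.P.obj (.op (X ⊗ Y))} :
    H.P.map (snd X Y).op a ≤ b ↔ a ≤ H.all X Y b := H.all_adj X Y a b

theorem ex_le_iff {X Y : C} {a : H.P.obj (.op (X ⊗ Y))} {b : H.P.obj (.op Y)} :
    H.ex X Y a ≤ b ↔ a ≤ H.P.map (snd X Y).op b := H.ex_adj X Y a b

/-- Since pullback commutes with complements, uniqueness of adjoints makes the two quantifiers
De Morgan dual. -/
theorem compl_all (X Y : C) (a : H.P.obj (.op (X ⊗ Y))) : (H.all X Y a)ᶜ = H.ex X Y aᶜ := by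
  apply le_antisymm
  · rw [Ortholattice.compl_le_iff, ← map_snd_le_iff, OrthoHom.map_compl,
      Ortholattice.compl_le_iff, ← ex_le_iff]
  · rw [ex_le_iff, OrthoHom.map_compl]
    exact Ortholattice.compl_anti _ _ ((H.all_adj X Y).l_u_le a)

theorem compl_ex (X Y : C) (a : H.P.obj (.op (X ⊗ Y))) : (H.ex X Y a)ᶜ = H.all X Y aᶜ := by
  rw [← Ortholattice.compl_compl_eq (H.all X Y aᶜ), compl_all, Ortholattice.compl_compl_eq]

end QLHyperdoctrine

namespace TFSq

variable {Sg : Signature.{u}}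

/-! ### Substitution -/

theorem Formula.neg_neg {Φ : Ctx Sg} (A : Formula Sg Φ) : A.neg.neg = A := by
  induction A <;> simp_all [Formula.neg]

theorem Formula.neg_subst {Ψ Φ : Ctx Sg} (s : Subst Ψ Φ) (A : Formula Sg Ψ) :
    (A.subst s).neg = A.neg.subst s := by
  induction A generalizing Φ <;> simp_all [Formula.neg, Formula.subst]

/-- Composition of substitutions: first `s`, then `r`. -/
def Subst.comp {Ψ Φ Θ : Ctx Sg} (s : Subst Ψ Φ) (r : Subst Φ Θ) : Subst Ψ Θ :=
  fun _ y => (s _ y).subst r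

theorem Term.subst_subst {Ψ Φ Θ : Ctx Sg} (s : Subst Ψ Φ) (r : Subst Φ Θ) {σ : Ty Sg.Srt}
    (t : Term Sg Ψ σ) : (t.subst s).subst r = t.subst (s.comp r) := by
  induction t <;> simp_all [Term.subst, Subst.comp]

theorem Term.subst_var {Φ : Ctx Sg} {σ : Ty Sg.Srt} (t : Term Sg Φ σ) :
    t.subst (fun _ y => .var y) = t := by
  induction t <;> simp_all [Term.subst]

theorem Subst.ext_cons {Ψ Φ : Ctx Sg} {σ : Ty Sg.Srt} {s r : Subst (σ :: Ψ) Φ}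
    (h0 : s _ .zero = r _ .zero) (h1 : ∀ τ (y : Var Ψ τ), s _ y.succ = r _ y.succ) : s = r := by
  funext τ y
  cases y with
  | zero => exact h0
  | succ y => exact h1 _ y

theorem Term.subst_wk_cons {Ψ Φ : Ctx Sg} {σ τ : Ty Sg.Srt} (t : Term Sg Φ σ)
    (s : Subst Ψ Φ) (a : Term Sg Ψ τ) :
    (a.subst (Subst.wk σ Ψ)).subst (Subst.cons t s) = a.subst s := by
  rw [Term.subst_subst]; rfl

theorem Subst.lift_comp_lift {Ψ Φ Θ : Ctx Sg} (σ : Ty Sg.Srt) (s : Subst Ψ Φ) (r : Subst Φ Θ) :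
    (s.lift σ).comp (r.lift σ) = (s.comp r).lift σ := by
  refine Subst.ext_cons rfl fun τ y => ?_
  simp only [Subst.comp, Subst.lift, Subst.cons, Term.subst_subst]
  rfl

theorem Subst.lift_var (σ : Ty Sg.Srt) (Φ : Ctx Sg) :
    Subst.lift σ (fun _ (y : Var Φ _) => (Term.var y : Term Sg Φ _)) = fun _ y => .var y :=
  Subst.ext_cons rfl fun _ _ => rfl

theorem Formula.subst_subst {Ψ Φ Θ : Ctx Sg} (s : Subst Ψ Φ) (r : Subst Φ Θ)
    (A : Formula Sg Ψ) : (A.subst s).subst r = A.subst (s.comp r) := by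
  induction A generalizing Φ Θ <;>
    simp_all [Formula.subst, Term.subst_subst, Subst.lift_comp_lift]

theorem Formula.subst_var {Φ : Ctx Sg} (A : Formula Sg Φ) :
    A.subst (fun _ y => .var y) = A := by
  induction A <;> simp_all [Formula.subst, Term.subst_var, Subst.lift_var]

/-- Instantiating the last variable after substituting under the binder is a single simultaneous
substitution. -/
theorem Formula.subst_lift_inst {Ψ Φ : Ctx Sg} {σ : Ty Sg.Srt} (s : Subst Ψ Φ)
    (A : Formula Sg (σ :: Ψ)) (t : Term Sg Φ σ) :
    (A.subst (s.lift σ)).inst t = A.subst (Subst.cons t s) := by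
  rw [Formula.inst, Formula.subst_subst]
  congr 1
  refine Subst.ext_cons rfl fun τ y => ?_
  simp only [Subst.comp, Subst.lift, Subst.cons, Subst.single, Term.subst_wk_cons, Term.subst_var]

theorem Formula.neg_inst {Φ : Ctx Sg} {σ : Ty Sg.Srt} (A : Formula Sg (σ :: Φ))
    (t : Term Sg Φ σ) : (A.inst t).neg = A.neg.inst t := Formula.neg_subst _ _

/-! ### Soundness -/

section Soundness

variable {C : Type v} [Category.{w} C] [CartesianMonoidalCategory C]

theorem tuple_evalVar {S : Type u} (b : S → C) {X : C} {Ψ : List (Ty S)}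
    (g : ∀ τ, Var Ψ τ → (X ⟶ evalTy b τ)) {τ : Ty S} (y : Var Ψ τ) :
    tuple b Ψ g ≫ evalVar b y = g τ y := by
  induction y with
  | zero => simp [tuple, evalVar]
  | succ y ih => simp [tuple, evalVar, ih]

theorem comp_tuple {S : Type u} (b : S → C) {X Y : C} (f : X ⟶ Y) (Ψ : List (Ty S))
    (g : ∀ τ, Var Ψ τ → (Y ⟶ evalTy b τ)) :
    f ≫ tuple b Ψ g = tuple b Ψ (fun τ y => f ≫ g τ y) := by
  induction Ψ with
  | nil => exact toUnit_unique _ _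
  | cons σ Ψ ih => simp [tuple, ih, comp_lift]

theorem tuple_evalVar_eq_id {S : Type u} (b : S → C) (Ψ : List (Ty S)) :
    tuple b Ψ (fun _ y => evalVar b y) = 𝟙 (evalCtx b Ψ) := by
  induction Ψ with
  | nil => exact toUnit_unique _ _
  | cons σ Ψ ih =>
    have h : tuple b Ψ (fun τ y => evalVar b (Var.succ (τ := σ) y)) = snd _ _ := by
      simp only [evalVar]
      rw [← comp_tuple, ih, Category.comp_id]
    exact (congrArg (lift _) h).trans lift_fst_snd

namespace Interp

variable {H : QLHyperdoctrine.{v, w, x} C} (I : Interp Sg H)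

/-- The morphism interpreting a substitution. -/
def substHom {Ψ Φ : Ctx Sg} (s : Subst Ψ Φ) : evalCtx I.srt Φ ⟶ evalCtx I.srt Ψ :=
  tuple I.srt Ψ (fun τ y => I.term (s τ y))

theorem term_subst {Ψ Φ : Ctx Sg} (s : Subst Ψ Φ) {σ : Ty Sg.Srt} (t : Term Sg Ψ σ) :
    I.term (t.subst s) = I.substHom s ≫ I.term t := by
  induction t with
  | var y => exact (tuple_evalVar I.srt (fun τ y => I.term (s τ y)) y).symm
  | app f ts ih => simp only [Term.subst, term, ih, ← comp_tuple, Category.assoc]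
  | star => exact (comp_toUnit (I.substHom s)).symm
  | pair a b iha ihb => simp only [Term.subst, term, iha, ihb, comp_lift]
  | fst a ih => simp only [Term.subst, term, ih, Category.assoc]
  | snd a ih => simp only [Term.subst, term, ih, Category.assoc]

theorem substHom_var (Φ : Ctx Sg) :
    I.substHom (fun _ (y : Var Φ _) => (Term.var y : Term Sg Φ _)) = 𝟙 _ :=
  tuple_evalVar_eq_id _ _

theorem substHom_wk (σ : Ty Sg.Srt) (Φ : Ctx Sg) : I.substHom (Subst.wk σ Φ) = snd _ _ := by
  change tuple I.srt Φ (fun τ y => snd _ _ ≫ evalVar I.srt y) = _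
  rw [← comp_tuple, tuple_evalVar_eq_id, Category.comp_id]

theorem substHom_single {Φ : Ctx Sg} {σ : Ty Sg.Srt} (t : Term Sg Φ σ) :
    I.substHom (Subst.single t) = CartesianMonoidalCategory.lift (I.term t) (𝟙 _) := by
  rw [← substHom_var]; rfl

theorem substHom_lift {Ψ Φ : Ctx Sg} (σ : Ty Sg.Srt) (s : Subst Ψ Φ) :
    I.substHom (s.lift σ) = evalTy I.srt σ ◁ I.substHom s := by
  have h : tuple I.srt Ψ (fun τ y => I.term ((s τ y).subst (Subst.wk σ Φ))) =
      snd _ _ ≫ I.substHom s := by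
    simp only [term_subst, substHom_wk]
    exact (comp_tuple _ _ _ _).symm
  apply CartesianMonoidalCategory.hom_ext
  · rw [whiskerLeft_fst]; exact lift_fst _ _
  · rw [whiskerLeft_snd, ← h]; exact lift_snd _ _

/-- Substitution is pullback; at the quantifiers this is the Beck-Chevalley condition. -/
theorem formula_subst {Ψ Φ : Ctx Sg} (s : Subst Ψ Φ) (A : Formula Sg Ψ) :
    I.formula (A.subst s) = H.P.map (I.substHom s).op (I.formula A) := by
  induction A generalizing Φ with
  | atom R ts =>
    simp only [Formula.subst, formula, term_subst, ← comp_tuple, H.map_comp_apply]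
  | natom R ts =>
    simp only [Formula.subst, formula, term_subst, ← comp_tuple, H.map_comp_apply,
      OrthoHom.map_compl]
  | top => exact (map_top _).symm
  | bot => exact (map_bot _).symm
  | and A B ihA ihB => simp only [Formula.subst, formula, ihA, ihB, map_inf]
  | or A B ihA ihB => simp only [Formula.subst, formula, ihA, ihB, map_sup]
  | all σ A ih => simp only [Formula.subst, formula, ih, substHom_lift, H.all_beckChevalley]
  | ex σ A ih => simp only [Formula.subst, formula, ih, substHom_lift, H.ex_beckChevalley]

theorem formula_neg {Φ : Ctx Sg} (A : Formula Sg Φ) : I.formula A.neg = (I.formula A)ᶜ := by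
  induction A with
  | atom R ts => rfl
  | natom R ts => exact (Ortholattice.compl_compl_eq _).symm
  | top => exact Ortholattice.compl_top.symm
  | bot => exact Ortholattice.compl_bot.symm
  | and A B ihA ihB => simp only [Formula.neg, formula, ihA, ihB, Ortholattice.compl_inf]
  | or A B ihA ihB => simp only [Formula.neg, formula, ihA, ihB, Ortholattice.compl_sup]
  | all σ A ih => simp only [Formula.neg, formula, ih, H.compl_all]
  | ex σ A ih => simp only [Formula.neg, formula, ih, H.compl_ex]

theorem term_eq_of_termEq {Φ : Ctx Sg} {σ : Ty Sg.Srt} {t t' : Term Sg Φ σ} (h : TermEq t t') :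
    I.term t = I.term t' := by
  induction h with
  | refl => rfl
  | symm _ ih => exact ih.symm
  | trans _ _ ih ih' => exact ih.trans ih'
  | app f _ ih => simp only [term, ih]
  | pair _ _ ih ih' => simp only [term, ih, ih']
  | fst _ ih => simp only [term, ih]
  | snd _ ih => simp only [term, ih]
  | fst_pair a b => exact lift_fst _ _
  | snd_pair a b => exact lift_snd _ _
  | pair_eta a => simp only [term, ← comp_lift, lift_fst_snd, Category.comp_id]
  | unit_eta a => exact toUnit_unique _ _

/-- The meet of the interpretations of the formulas of a list. -/
def meet {Φ : Ctx Sg} (Γ : List (Formula Sg Φ)) : H.P.obj (.op (evalCtx I.srt Φ)) :=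
  (Γ.map I.formula).foldr (· ⊓ ·) ⊤

/-- The join of the interpretations of the formulas of a list. -/
def join {Φ : Ctx Sg} (Δ : List (Formula Sg Φ)) : H.P.obj (.op (evalCtx I.srt Φ)) :=
  (Δ.map I.formula).foldr (· ⊔ ·) ⊥

variable {Φ : Ctx Sg}

theorem meet_nil : I.meet ([] : List (Formula Sg Φ)) = ⊤ := rfl
theorem join_nil : I.join ([] : List (Formula Sg Φ)) = ⊥ := rfl

theorem meet_cons (A : Formula Sg Φ) (Γ : List (Formula Sg Φ)) :
    I.meet (A :: Γ) = I.formula A ⊓ I.meet Γ := rfl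

theorem join_cons (A : Formula Sg Φ) (Γ : List (Formula Sg Φ)) :
    I.join (A :: Γ) = I.formula A ⊔ I.join Γ := rfl

theorem meet_singleton (A : Formula Sg Φ) : I.meet [A] = I.formula A := by
  rw [meet_cons, meet_nil, inf_top_eq]

theorem join_singleton (A : Formula Sg Φ) : I.join [A] = I.formula A := by
  rw [join_cons, join_nil, sup_bot_eq]

theorem meet_append (Γ Γ' : List (Formula Sg Φ)) : I.meet (Γ ++ Γ') = I.meet Γ ⊓ I.meet Γ' := by
  induction Γ with
  | nil => rw [List.nil_append, meet_nil, top_inf_eq]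
  | cons A Γ ih => rw [List.cons_append, meet_cons, meet_cons, ih, inf_assoc]

theorem join_append (Γ Γ' : List (Formula Sg Φ)) : I.join (Γ ++ Γ') = I.join Γ ⊔ I.join Γ' := by
  induction Γ with
  | nil => rw [List.nil_append, join_nil, bot_sup_eq]
  | cons A Γ ih => rw [List.cons_append, join_cons, join_cons, ih, sup_assoc]

theorem meet_perm {Γ Γ' : List (Formula Sg Φ)} (h : Γ.Perm Γ') : I.meet Γ = I.meet Γ' := by
  induction h with
  | nil => rfl
  | cons A _ ih => rw [meet_cons, meet_cons, ih]
  | swap A B Γ => simp only [meet_cons]; exact inf_left_comm _ _ _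
  | trans _ _ ih ih' => exact ih.trans ih'

theorem join_perm {Γ Γ' : List (Formula Sg Φ)} (h : Γ.Perm Γ') : I.join Γ = I.join Γ' := by
  induction h with
  | nil => rfl
  | cons A _ ih => rw [join_cons, join_cons, ih]
  | swap A B Γ => simp only [join_cons]; exact sup_left_comm _ _ _
  | trans _ _ ih ih' => exact ih.trans ih'

theorem meet_subst {Ψ : Ctx Sg} (s : Subst Ψ Φ) (Γ : List (Formula Sg Ψ)) :
    I.meet (Γ.map (Formula.subst s)) = H.P.map (I.substHom s).op (I.meet Γ) := by
  induction Γ with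
  | nil => exact (map_top _).symm
  | cons A Γ ih => rw [List.map_cons, meet_cons, meet_cons, ih, formula_subst, map_inf]

theorem join_subst {Ψ : Ctx Sg} (s : Subst Ψ Φ) (Γ : List (Formula Sg Ψ)) :
    I.join (Γ.map (Formula.subst s)) = H.P.map (I.substHom s).op (I.join Γ) := by
  induction Γ with
  | nil => exact (map_bot _).symm
  | cons A Γ ih => rw [List.map_cons, join_cons, join_cons, ih, formula_subst, map_sup]

theorem meet_neg (Γ : List (Formula Sg Φ)) : I.meet (Γ.map Formula.neg) = (I.join Γ)ᶜ := by
  induction Γ with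
  | nil => exact Ortholattice.compl_bot.symm
  | cons A Γ ih => rw [List.map_cons, meet_cons, join_cons, ih, formula_neg, Ortholattice.compl_sup]

theorem join_neg (Γ : List (Formula Sg Φ)) : I.join (Γ.map Formula.neg) = (I.meet Γ)ᶜ := by
  induction Γ with
  | nil => exact Ortholattice.compl_top.symm
  | cons A Γ ih => rw [List.map_cons, meet_cons, join_cons, ih, formula_neg, Ortholattice.compl_inf]

theorem formula_all_le_inst {σ : Ty Sg.Srt} (A : Formula Sg (σ :: Φ)) (t : Term Sg Φ σ) :
    I.formula (.all σ A) ≤ I.formula (A.inst t) := by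
  have h := OrderHomClass.mono (H.P.map (I.substHom (Subst.single t)).op).hom'
    ((H.all_adj (evalTy I.srt σ) (evalCtx I.srt Φ)).l_u_le (I.formula A))
  rw [Formula.inst, formula_subst]
  refine le_trans (le_of_eq ?_) h
  change _ = H.P.map _ (H.P.map _ _)
  rw [← H.map_comp_apply, substHom_single, lift_snd, H.map_id_apply]
  rfl

theorem formula_inst_le_ex {σ : Ty Sg.Srt} (A : Formula Sg (σ :: Φ)) (t : Term Sg Φ σ) :
    I.formula (A.inst t) ≤ I.formula (.ex σ A) := by
  have h := I.formula_all_le_inst A.neg t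
  rw [← Formula.neg_inst, formula_neg, Ortholattice.le_compl_iff, ← formula_neg] at h
  simpa only [Formula.neg, Formula.neg_neg] using h

theorem valid_of_derivable {Γ Δ : List (Formula Sg Φ)} (h : Derivable Γ Δ) : I.Valid Γ Δ := by
  change I.meet Γ ≤ I.join Δ
  induction h with
  | id A => rw [meet_singleton, join_singleton]
  | cutL _ _ ih ih' =>
    rw [meet_append]
    rw [join_singleton] at ih
    exact (inf_le_inf_right _ ih).trans ih'
  | cutR _ _ ih ih' =>
    rw [join_append]
    rw [meet_singleton] at ih'
    exact ih.trans (sup_le_sup_right ih' _)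
  | exchL h _ ih => rwa [← I.meet_perm h]
  | exchR h _ ih => rwa [← I.join_perm h]
  | weakL A _ ih => exact inf_le_right.trans ih
  | weakR A _ ih => exact ih.trans le_sup_right
  | contrL _ ih => exact (le_inf inf_le_left le_rfl).trans ih
  | contrR _ ih => exact ih.trans (sup_le le_sup_left le_rfl)
  | trL _ ih =>
    rw [meet_append, meet_neg, join_nil, ← Ortholattice.inf_compl_eq (I.join _)]
    exact inf_le_inf_right _ ih
  | trR _ ih =>
    rw [join_append, join_neg, meet_nil, ← Ortholattice.sup_compl_eq (I.meet _), sup_comm]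
    exact sup_le_sup_left ih _
  | topR Γ => rw [join_singleton]; exact le_top
  | botL Δ => rw [meet_singleton]; exact bot_le
  | andL₁ B _ ih => rw [meet_singleton] at *; exact inf_le_left.trans ih
  | andL₂ B _ ih => rw [meet_singleton] at *; exact inf_le_right.trans ih
  | andR _ _ ih ih' => rw [join_singleton] at *; exact le_inf ih ih'
  | orL _ _ ih ih' => rw [meet_singleton] at *; exact sup_le ih ih'
  | orR₁ B _ ih => rw [join_singleton] at *; exact ih.trans le_sup_left
  | orR₂ B _ ih => rw [join_singleton] at *; exact ih.trans le_sup_right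
  | allL t _ ih => rw [meet_singleton] at *; exact (I.formula_all_le_inst _ t).trans ih
  | allR _ ih =>
    rw [join_singleton] at *
    change I.meet (List.map (Formula.subst _) _) ≤ _ at ih
    rw [meet_subst, substHom_wk] at ih
    exact (H.all_adj _ _).le_u ih
  | exL _ ih =>
    rw [meet_singleton] at *
    change _ ≤ I.join (List.map (Formula.subst _) _) at ih
    rw [join_subst, substHom_wk] at ih
    exact (H.ex_adj _ _).l_le ih
  | exR t _ ih => rw [join_singleton] at *; exact ih.trans (I.formula_inst_le_ex _ t)
  | subst s _ ih =>
    rw [meet_subst, join_subst]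
    exact OrderHomClass.mono (H.P.map (I.substHom s).op).hom' ih
  | conv A h =>
    rw [meet_singleton, join_singleton, Formula.inst, Formula.inst, formula_subst, formula_subst,
      substHom_single, substHom_single, I.term_eq_of_termEq h]

end Interp

end Soundness

/-! ### Derived rules -/

theorem Formula.neg_map_wk {Φ : Ctx Sg} (σ : Ty Sg.Srt) (Γ : List (Formula Sg Φ)) :
    (Γ.map (Formula.wk σ)).map Formula.neg = (Γ.map Formula.neg).map (Formula.wk σ) := by
  simp [Formula.wk, Formula.neg_subst, Function.comp_def]

namespace Derivable

variable {Φ : Ctx Sg}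

theorem trans {A B D : Formula Sg Φ} (h : Derivable [A] [B]) (h' : Derivable [B] [D]) :
    Derivable [A] [D] := cutL (Γ := []) h h'

/-- Contraposition. The transfer rules do not yield it directly (`A, B^⊥ ⊢` does not imply
`A ⊢ B` in orthologic), but the calculus is self-dual: negating both sides of a derivation and
exchanging them turns each rule into its mirror image. -/
theorem contrapose {Γ Δ : List (Formula Sg Φ)} (h : Derivable Γ Δ) :
    Derivable (Δ.map Formula.neg) (Γ.map Formula.neg) := by
  have hinv : ∀ {Φ : Ctx Sg} (Γ : List (Formula Sg Φ)),
      (Γ.map Formula.neg).map Formula.neg = Γ := fun Γ => by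
    simp [Function.comp_def, Formula.neg_neg]
  induction h with
  | id A => exact id _
  | cutL _ _ ih ih' => rw [List.map_append]; exact cutR ih' ih
  | cutR _ _ ih ih' => rw [List.map_append]; exact cutL ih' ih
  | exchL h _ ih => exact exchR (h.map _) ih
  | exchR h _ ih => exact exchL (h.map _) ih
  | weakL A _ ih => exact weakR _ ih
  | weakR A _ ih => exact weakL _ ih
  | contrL _ ih => exact contrR ih
  | contrR _ ih => exact contrL ih
  | trL h _ => rw [List.map_append, hinv]; exact trR h
  | trR h _ => rw [List.map_append, hinv]; exact trL h
  | topR Γ => exact botL _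
  | botL Δ => exact topR _
  | andL₁ B _ ih => exact orR₁ _ ih
  | andL₂ B _ ih => exact orR₂ _ ih
  | andR _ _ ih ih' => exact orL ih ih'
  | orL _ _ ih ih' => exact andR ih ih'
  | orR₁ B _ ih => exact andL₁ _ ih
  | orR₂ B _ ih => exact andL₂ _ ih
  | allL t _ ih =>
    refine exR t ?_
    rw [← Formula.neg_inst]
    exact ih
  | allR _ ih =>
    refine exL ?_
    rw [← Formula.neg_map_wk]
    exact ih
  | exL _ ih =>
    refine allR ?_
    rw [← Formula.neg_map_wk]
    exact ih
  | exR t _ ih =>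
    refine allL t ?_
    rw [← Formula.neg_inst]
    exact ih
  | subst s _ ih =>
    simpa only [List.map_map, Function.comp_def, Formula.neg_subst] using subst s ih
  | conv A h =>
    simp only [List.map, Formula.neg_inst]
    exact conv _ h.symm

theorem subst_one {Ψ : Ctx Sg} (s : Subst Ψ Φ) {A B : Formula Sg Ψ} (h : Derivable [A] [B]) :
    Derivable [A.subst s] [B.subst s] := h.subst s

theorem neg_one {A B : Formula Sg Φ} (h : Derivable [A] [B]) : Derivable [B.neg] [A.neg] :=
  h.contrapose

theorem and_neg (A : Formula Sg Φ) : Derivable [.and A A.neg] [.bot] := by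
  have h : Derivable [A, A.neg] [.bot] := weakR _ (trL (id A))
  have h' : Derivable [.and A A.neg, A.neg] [.bot] := cutL (Γ' := [_]) (andL₁ _ (id A)) h
  exact contrL (cutL (Γ' := [_]) (andL₂ _ (id _)) (exchL (List.Perm.swap _ _ _) h'))

theorem all_mono {σ : Ty Sg.Srt} {A B : Formula Sg (σ :: Φ)} (h : Derivable [A] [B]) :
    Derivable [.all σ A] [.all σ B] := by
  refine allR (allL (.var .zero) ?_)
  rw [Formula.subst_lift_inst]
  convert h
  rw [← Formula.subst_var A]
  congr 1
  · exact Subst.ext_cons rfl fun _ _ => rfl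
  · exact Formula.subst_var A

/-- Substitutions that are pointwise equal in the type theory give interderivable formulas. Only a
part of the variables is replaced: `r` says which variables of `Ω` are sent to terms through `Ψ`
and which are sent to fixed terms, so that the variables of `Ψ` can be treated one at a time. -/
theorem subst_conv_aux {Ψ : Ctx Sg} (s s' : Subst Ψ Φ) (h : ∀ τ y, TermEq (s τ y) (s' τ y))
    {Ω : Ctx Sg} (r : ∀ τ, Var Ω τ → Var Ψ τ ⊕ Term Sg Φ τ) (A : Formula Sg Ω) :
    Derivable [A.subst fun τ y => (r τ y).elim (s τ) _root_.id]
      [A.subst fun τ y => (r τ y).elim (s' τ) _root_.id] := by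
  induction Ψ with
  | nil =>
    have : s = s' := by funext τ y; cases y
    rw [this]
    exact id _
  | cons σ Ψ ih =>
    -- First the variable `zero` is converted, with the other variables sent by `s`.
    let B : Formula Sg (σ :: Φ) := A.subst fun τ y =>
      (r τ y).elim ((Subst.lift σ fun τ y => s τ (.succ y)) τ) (Term.subst (Subst.wk σ Φ))
    have hB : ∀ t : Term Sg Φ σ, B.inst t = A.subst fun τ y =>
        (r τ y).elim ((Subst.cons t fun τ y => s τ (.succ y)) τ) _root_.id := by
      intro t
      rw [Formula.inst, Formula.subst_subst]
      congr 1
      funext τ y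
      rw [Subst.comp]
      rcases r τ y with y | u
      · cases y with
        | zero => rfl
        | succ y =>
          exact (Term.subst_wk_cons _ _ _).trans (Term.subst_var _)
      · exact (Term.subst_wk_cons _ _ _).trans (Term.subst_var _)
    have h₁ := conv B (h _ .zero)
    rw [hB, hB] at h₁
    -- Then `s' zero` counts as a fixed term and the induction hypothesis converts the rest.
    have h₂ := ih (fun τ y => s τ (.succ y)) (fun τ y => s' τ (.succ y)) (fun τ y => h _ _)
      (fun τ y => (r τ y).elim (fun z => match τ, z with
        | _, .zero => .inr (s' _ .zero)
        | _, .succ z => .inl z) .inr)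
    convert h₁.trans ?_ using 3
    · funext τ y
      rcases r τ y with y | u
      · cases y <;> rfl
      · rfl
    · convert h₂ using 3
      all_goals
        funext τ y
        rcases r τ y with y | u
        · cases y <;> rfl
        · rfl

theorem subst_conv {Ψ : Ctx Sg} {s s' : Subst Ψ Φ} (h : ∀ τ y, TermEq (s τ y) (s' τ y))
    (A : Formula Sg Ψ) : Derivable [A.subst s] [A.subst s'] :=
  subst_conv_aux s s' h (fun _ y => .inl y) A

end Derivable

/-- The conjunction of a list of formulas. -/
def Formula.bigAnd {Φ : Ctx Sg} (Γ : List (Formula Sg Φ)) : Formula Sg Φ := Γ.foldr .and .top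

/-- The disjunction of a list of formulas. -/
def Formula.bigOr {Φ : Ctx Sg} (Δ : List (Formula Sg Φ)) : Formula Sg Φ := Δ.foldr .or .bot

theorem Derivable.bigAnd {Φ : Ctx Sg} (Γ : List (Formula Sg Φ)) :
    Derivable Γ [Formula.bigAnd Γ] := by
  induction Γ with
  | nil => exact topR _
  | cons A Γ ih =>
    refine andR ?_ (weakL A ih)
    exact exchL List.perm_append_comm
      (Γ.rec (id A) fun B _ h => weakL B h : Derivable (Γ ++ [A]) [A])

theorem Derivable.bigOr {Φ : Ctx Sg} (Δ : List (Formula Sg Φ)) :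
    Derivable [Formula.bigOr Δ] Δ := by
  induction Δ with
  | nil => exact botL _
  | cons A Δ ih =>
    refine orL ?_ (weakR A ih)
    exact exchR List.perm_append_comm
      (Δ.rec (id A) fun B _ h => weakR B h : Derivable [A] (Δ ++ [A]))

theorem Derivable.of_bigAnd_bigOr {Φ : Ctx Sg} {Γ Δ : List (Formula Sg Φ)}
    (h : Derivable [Formula.bigAnd Γ] [Formula.bigOr Δ]) : Derivable Γ Δ := by
  have h₁ : Derivable (Γ ++ []) [Formula.bigOr Δ] := cutL (Derivable.bigAnd Γ) h
  have h₂ : Derivable (Γ ++ []) (Δ ++ []) := cutR h₁ (Derivable.bigOr Δ)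
  simpa using h₂

/-! ### The base category of the term model -/

theorem TermEq.subst {Ψ Φ : Ctx Sg} {σ : Ty Sg.Srt} {t t' : Term Sg Ψ σ} (h : TermEq t t')
    (s : Subst Ψ Φ) : TermEq (t.subst s) (t'.subst s) := by
  induction h with
  | refl => exact refl _
  | symm _ ih => exact ih.symm
  | trans _ _ ih ih' => exact ih.trans ih'
  | app f _ ih => exact app f ih
  | pair _ _ ih ih' => exact pair ih ih'
  | fst _ ih => exact fst ih
  | snd _ ih => exact snd ih
  | fst_pair a b => exact fst_pair _ _
  | snd_pair a b => exact snd_pair _ _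
  | pair_eta a => exact pair_eta _
  | unit_eta a => exact unit_eta _

theorem TermEq.subst_congr {Ψ Φ : Ctx Sg} {σ : Ty Sg.Srt} (t : Term Sg Ψ σ) {s s' : Subst Ψ Φ}
    (h : ∀ τ y, TermEq (s τ y) (s' τ y)) : TermEq (t.subst s) (t.subst s') := by
  induction t with
  | var y => exact h _ y
  | app f ts ih => exact app f fun τ y => ih τ y
  | star => exact refl _
  | pair a b iha ihb => exact pair iha ihb
  | fst a ih => exact fst ih
  | snd a ih => exact snd ih

/-- The substitution of a term for the variable of a context of length one. -/
def Subst.one {Φ : Ctx Sg} {σ : Ty Sg.Srt} (t : Term Sg Φ σ) : Subst [σ] Φ :=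
  Subst.cons t fun _ y => nomatch y

theorem Subst.ext_one {Φ : Ctx Sg} {σ : Ty Sg.Srt} {s r : Subst [σ] Φ}
    (h : s _ .zero = r _ .zero) : s = r :=
  Subst.ext_cons h fun _ y => nomatch y

theorem Subst.one_comp {Φ Θ : Ctx Sg} {σ : Ty Sg.Srt} (t : Term Sg Φ σ) (r : Subst Φ Θ) :
    (Subst.one t).comp r = Subst.one (t.subst r) := Subst.ext_one rfl

theorem Subst.one_var (σ : Ty Sg.Srt) :
    Subst.one (.var .zero) = fun _ (y : Var [σ] _) => (Term.var y : Term Sg _ _) :=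
  Subst.ext_one rfl

theorem TermEq.one {Φ : Ctx Sg} {σ : Ty Sg.Srt} {t t' : Term Sg Φ σ} (h : TermEq t t') (τ)
    (y : Var [σ] τ) : TermEq (Subst.one t τ y) (Subst.one t' τ y) := by
  cases y with
  | zero => exact h
  | succ y => cases y

/-- Terms up to provable equality. -/
instance termSetoid (Φ : Ctx Sg) (σ : Ty Sg.Srt) : Setoid (Term Sg Φ σ) :=
  ⟨TermEq, .refl, .symm, .trans⟩

/-- The objects of the base category of the term model: the types of the signature. The product
of `σ` and `τ` is the product type, and arrows `σ ⟶ τ` are terms of type `τ` with one variable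
of type `σ`. -/
structure TermCat (Sg : Signature.{u}) : Type u where
  ty : Ty Sg.Srt

namespace TermCat

instance : Category.{u} (TermCat Sg) where
  Hom X Y := Quotient (termSetoid [X.ty] Y.ty)
  id X := ⟦.var .zero⟧
  comp f g := Quotient.map₂ (fun a b => b.subst (Subst.one a))
    (fun _ _ h _ b' h' => (TermEq.subst h' _).trans (TermEq.subst_congr b' (TermEq.one h))) f g
  id_comp := by
    rintro X Y ⟨a⟩
    refine congrArg (Quotient.mk _) (?_ : Term.subst _ _ = _)
    rw [Subst.one_var, Term.subst_var]
  comp_id := by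
    rintro X Y ⟨a⟩
    rfl
  assoc := by
    rintro W X Y Z ⟨a⟩ ⟨b⟩ ⟨c⟩
    refine congrArg (Quotient.mk _) (?_ : Term.subst _ _ = Term.subst _ (Term.subst _ _))
    rw [Term.subst_subst, Subst.one_comp]

/-- The arrow given by a term. -/
def ofTerm {X Y : TermCat Sg} (t : Term Sg [X.ty] Y.ty) : X ⟶ Y := Quotient.mk (termSetoid _ _) t

theorem ofTerm_sound {X Y : TermCat Sg} {t t' : Term Sg [X.ty] Y.ty} (h : TermEq t t') :
    ofTerm t = ofTerm t' := Quotient.sound h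

theorem ofTerm_surjective {X Y : TermCat Sg} (f : X ⟶ Y) : ∃ t, f = ofTerm t := by
  obtain ⟨t⟩ := f
  exact ⟨t, rfl⟩

/-- The first projection from a product type. -/
abbrev pr₁ (σ τ : Ty Sg.Srt) : Term Sg [σ.prod τ] σ := .fst (.var .zero)

/-- The second projection from a product type. -/
abbrev pr₂ (σ τ : Ty Sg.Srt) : Term Sg [σ.prod τ] τ := .snd (.var .zero)

/-- The type `1` is terminal. -/
def terminalCone : Limits.LimitCone (Functor.empty.{0} (TermCat Sg)) where
  cone := Limits.asEmptyCone ⟨.unit⟩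
  isLimit := Limits.IsTerminal.ofUniqueHom (fun _ => ofTerm .star) fun X f => by
    obtain ⟨t, rfl⟩ := ofTerm_surjective f
    exact ofTerm_sound (.unit_eta t)

/-- Product types are products. -/
noncomputable def productCone (X Y : TermCat Sg) : Limits.LimitCone (Limits.pair X Y) where
  cone := Limits.BinaryFan.mk (P := ⟨X.ty.prod Y.ty⟩) (ofTerm (pr₁ _ _)) (ofTerm (pr₂ _ _))
  isLimit := Limits.BinaryFan.IsLimit.mk _
    (fun {T} f g => Quotient.map₂ (fun a b => Term.pair a b)
      (fun _ _ h _ _ h' => TermEq.pair h h') f g)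
    (by
      rintro T ⟨f⟩ ⟨g⟩
      exact ofTerm_sound (.fst_pair f g))
    (by
      rintro T ⟨f⟩ ⟨g⟩
      exact ofTerm_sound (.snd_pair f g))
    (by
      rintro T ⟨f⟩ ⟨g⟩ ⟨m⟩ hf hg
      exact ofTerm_sound ((TermEq.pair_eta m).symm.trans
        (.pair (Quotient.exact hf) (Quotient.exact hg))))

noncomputable instance : CartesianMonoidalCategory (TermCat Sg) :=
  .ofChosenFiniteProducts terminalCone productCone

theorem lift_ofTerm_ofTerm {X Y Z : TermCat Sg} (a : Term Sg [X.ty] Y.ty) (b : Term Sg [X.ty] Z.ty) :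
    lift (ofTerm a) (ofTerm b) = ofTerm (Y := Y ⊗ Z) (.pair a b) := by
  apply CartesianMonoidalCategory.hom_ext
  · rw [lift_fst]; exact (ofTerm_sound (.fst_pair a b)).symm
  · rw [lift_snd]; exact (ofTerm_sound (.snd_pair a b)).symm

end TermCat

/-! ### The fibres of the term model -/

/-- Formulas up to interderivability. -/
instance formulaSetoid (Φ : Ctx Sg) : Setoid (Formula Sg Φ) where
  r A B := Derivable [A] [B] ∧ Derivable [B] [A]
  iseqv :=
    { refl := fun A => ⟨.id A, .id A⟩
      symm := fun h => ⟨h.2, h.1⟩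
      trans := fun h h' => ⟨h.1.trans h'.1, h'.2.trans h.2⟩ }

/-- The Lindenbaum algebra of the formulas in context `Φ`. -/
def Lind {Sg : Signature.{u}} (Φ : Ctx Sg) : Type u := Quotient (formulaSetoid Φ)

namespace Lind

variable {Φ : Ctx Sg}

/-- The class of a formula. -/
def mk (A : Formula Sg Φ) : Lind Φ := Quotient.mk (formulaSetoid Φ) A

theorem mk_surjective (a : Lind Φ) : ∃ A, a = mk A := by
  obtain ⟨A⟩ := a
  exact ⟨A, rfl⟩

instance : Ortholattice (Lind Φ) where
  le := Quotient.lift₂ (fun A B => Derivable [A] [B]) fun _ _ _ _ h h' =>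
    propext ⟨fun k => (h.2.trans k).trans h'.1, fun k => (h.1.trans k).trans h'.2⟩
  le_refl := by
    rintro ⟨A⟩
    exact .id A
  le_trans := by
    rintro ⟨A⟩ ⟨B⟩ ⟨D⟩
    exact Derivable.trans
  le_antisymm := by
    rintro ⟨A⟩ ⟨B⟩ h h'
    exact Quotient.sound ⟨h, h'⟩
  inf := Quotient.map₂ .and fun _ _ h _ _ h' =>
    ⟨.andR (.andL₁ _ h.1) (.andL₂ _ h'.1), .andR (.andL₁ _ h.2) (.andL₂ _ h'.2)⟩
  inf_le_left := by
    rintro ⟨A⟩ ⟨B⟩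
    exact .andL₁ _ (.id A)
  inf_le_right := by
    rintro ⟨A⟩ ⟨B⟩
    exact .andL₂ _ (.id B)
  le_inf := by
    rintro ⟨A⟩ ⟨B⟩ ⟨D⟩
    exact .andR
  sup := Quotient.map₂ .or fun _ _ h _ _ h' =>
    ⟨.orL (.orR₁ _ h.1) (.orR₂ _ h'.1), .orL (.orR₁ _ h.2) (.orR₂ _ h'.2)⟩
  le_sup_left := by
    rintro ⟨A⟩ ⟨B⟩
    exact .orR₁ _ (.id A)
  le_sup_right := by
    rintro ⟨A⟩ ⟨B⟩
    exact .orR₂ _ (.id B)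
  sup_le := by
    rintro ⟨A⟩ ⟨B⟩ ⟨D⟩
    exact .orL
  top := mk .top
  le_top := by
    rintro ⟨A⟩
    exact .topR _
  bot := mk .bot
  bot_le := by
    rintro ⟨A⟩
    exact .botL _
  compl := Quotient.map .neg fun _ _ h => ⟨h.2.neg_one, h.1.neg_one⟩
  compl_compl_eq := by
    rintro ⟨A⟩
    exact congrArg mk A.neg_neg
  compl_anti := by
    rintro ⟨A⟩ ⟨B⟩ h
    exact Derivable.neg_one h
  inf_compl_eq := by
    rintro ⟨A⟩
    exact Quotient.sound ⟨.and_neg A, .botL _⟩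
  sup_compl_eq := by
    rintro ⟨A⟩
    refine Quotient.sound ⟨.topR _, ?_⟩
    have h : Derivable [.top] [.or A.neg.neg A.neg.neg.neg] := (Derivable.and_neg A.neg).neg_one
    rwa [Formula.neg_neg] at h

/-- Substitution of formulas, as a homomorphism of Lindenbaum algebras. -/
def subst {Ψ : Ctx Sg} (s : Subst Ψ Φ) : OrthoHom (Lind Ψ) (Lind Φ) where
  toFun := Quotient.map (Formula.subst s) fun _ _ h => ⟨h.1.subst_one s, h.2.subst_one s⟩
  map_sup' := by
    rintro ⟨A⟩ ⟨B⟩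
    rfl
  map_inf' := by
    rintro ⟨A⟩ ⟨B⟩
    rfl
  map_top' := rfl
  map_bot' := rfl
  map_compl' := by
    rintro ⟨A⟩
    exact congrArg mk (A.neg_subst s).symm

theorem mk_subst_congr {Ψ : Ctx Sg} {s s' : Subst Ψ Φ} (h : ∀ τ y, TermEq (s τ y) (s' τ y))
    (A : Formula Sg Ψ) : mk (A.subst s) = mk (A.subst s') :=
  Quotient.sound ⟨.subst_conv h A, .subst_conv (fun τ y => (h τ y).symm) A⟩

theorem subst_congr {Ψ : Ctx Sg} {s s' : Subst Ψ Φ} (h : ∀ τ y, TermEq (s τ y) (s' τ y)) :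
    subst s = subst s' := by
  refine DFunLike.ext _ _ ?_
  rintro ⟨A⟩
  exact mk_subst_congr h A

end Lind

/-! ### The term model -/

/-- The Lindenbaum algebras of the contexts of length one, as a presheaf on the types. -/
def lindPresheaf (Sg : Signature.{u}) : (TermCat Sg)ᵒᵖ ⥤ QL.{u} where
  obj X := ⟨Lind [X.unop.ty]⟩
  map f := ⟨Quotient.lift (fun t => Lind.subst (Subst.one t))
    (fun _ _ h => Lind.subst_congr (TermEq.one h)) f.unop⟩
  map_id X := by
    refine congrArg QL.Hom.mk (DFunLike.ext _ _ ?_)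
    rintro ⟨A⟩
    refine congrArg Lind.mk ?_
    rw [Subst.one_var, Formula.subst_var]
  map_comp := by
    rintro ⟨X⟩ ⟨Y⟩ ⟨Z⟩ ⟨⟨f⟩⟩ ⟨⟨g⟩⟩
    refine congrArg QL.Hom.mk (DFunLike.ext _ _ ?_)
    rintro ⟨A⟩
    refine congrArg Lind.mk ?_
    rw [Formula.subst_subst, Subst.one_comp]

/-- The pair of the last two variables. -/
abbrev Subst.pairVars (σ : Ty Sg.Srt) (Φ : Ctx Sg) (τ : Ty Sg.Srt) :
    Subst [σ.prod τ] (σ :: τ :: Φ) :=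
  Subst.one (.pair (.var .zero) (.var (.succ .zero)))

/-- Universal quantification over the first component of a variable of product type. -/
def Lind.all (σ τ : Ty Sg.Srt) : Lind (Sg := Sg) [σ.prod τ] → Lind (Sg := Sg) [τ] :=
  Quotient.map (fun A => .all σ (A.subst (Subst.pairVars σ [] τ))) fun _ _ h =>
    ⟨(h.1.subst_one _).all_mono, (h.2.subst_one _).all_mono⟩

theorem Lind.subst_le_iff_le_all (σ τ : Ty Sg.Srt) (b : Lind (Sg := Sg) [τ])
    (a : Lind (Sg := Sg) [σ.prod τ]) :
    Lind.subst (Subst.one (TermCat.pr₂ σ τ)) b ≤ a ↔ b ≤ Lind.all σ τ a := by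
  obtain ⟨A, rfl⟩ := mk_surjective a
  obtain ⟨B, rfl⟩ := mk_surjective b
  constructor
  · intro (h : Derivable [_] [_])
    refine Derivable.allR (Derivable.trans ?_ (h.subst_one (Subst.pairVars σ [] τ)))
    rw [Formula.subst_subst, Subst.one_comp]
    refine Derivable.subst_conv (fun ρ y => ?_) B
    cases y with
    | zero => exact (TermEq.snd_pair _ _).symm
    | succ y => cases y
  · intro (h : Derivable [_] [_])
    refine (h.subst_one (Subst.one (TermCat.pr₂ σ τ))).trans (.allL (TermCat.pr₁ σ τ) ?_)
    rw [Formula.subst_lift_inst, Formula.subst_subst, Subst.one_comp]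
    conv => rhs; rw [← Formula.subst_var A, ← Subst.one_var]
    exact Derivable.subst_conv (TermEq.one (.pair_eta _)) A

theorem Lind.all_beckChevalley (σ : Ty Sg.Srt) {τ ρ : Ty Sg.Srt} (t : Term Sg [ρ] τ)
    (a : Lind (Sg := Sg) [σ.prod τ]) :
    Lind.subst (Subst.one t) (Lind.all σ τ a) = Lind.all σ ρ (Lind.subst
      (Subst.one (.pair (TermCat.pr₁ σ ρ) (t.subst (Subst.one (TermCat.pr₂ σ ρ))))) a) := by
  obtain ⟨A, rfl⟩ := mk_surjective a
  suffices h : mk ((A.subst (Subst.pairVars σ [] τ)).subst ((Subst.one t).lift σ)) =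
      mk ((A.subst (Subst.one (.pair (TermCat.pr₁ σ ρ)
        (t.subst (Subst.one (TermCat.pr₂ σ ρ)))))).subst (Subst.pairVars σ [] ρ)) from
    Quotient.sound ⟨(Quotient.exact h).1.all_mono, (Quotient.exact h).2.all_mono⟩
  rw [Formula.subst_subst, Formula.subst_subst, Subst.one_comp, Subst.one_comp]
  refine mk_subst_congr (TermEq.one (.pair (.symm (.fst_pair _ _)) ?_)) A
  change TermEq (t.subst _) ((t.subst _).subst _)
  rw [Term.subst_subst, Subst.one_comp]
  refine TermEq.subst_congr t fun κ y => ?_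
  cases y with
  | zero => exact (TermEq.snd_pair _ _).symm
  | succ y => cases y

/-- Existential quantification, as the De Morgan dual of universal quantification. -/
def Lind.ex (σ τ : Ty Sg.Srt) (a : Lind (Sg := Sg) [σ.prod τ]) : Lind (Sg := Sg) [τ] :=
  (Lind.all σ τ aᶜ)ᶜ

theorem Lind.ex_le_iff_le_subst (σ τ : Ty Sg.Srt) (a : Lind (Sg := Sg) [σ.prod τ])
    (b : Lind (Sg := Sg) [τ]) :
    Lind.ex σ τ a ≤ b ↔ a ≤ Lind.subst (Subst.one (TermCat.pr₂ σ τ)) b := by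
  rw [Lind.ex, Ortholattice.compl_le_iff, ← Lind.subst_le_iff_le_all, Ortholattice.le_compl_iff,
    OrthoHom.map_compl, Ortholattice.compl_compl_eq]

theorem Lind.ex_beckChevalley (σ : Ty Sg.Srt) {τ ρ : Ty Sg.Srt} (t : Term Sg [ρ] τ)
    (a : Lind (Sg := Sg) [σ.prod τ]) :
    Lind.subst (Subst.one t) (Lind.ex σ τ a) = Lind.ex σ ρ (Lind.subst
      (Subst.one (.pair (TermCat.pr₁ σ ρ) (t.subst (Subst.one (TermCat.pr₂ σ ρ))))) a) := by
  rw [Lind.ex, Lind.ex, OrthoHom.map_compl, Lind.all_beckChevalley, OrthoHom.map_compl]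

theorem TermCat.whiskerLeft_ofTerm (X : TermCat Sg) {Y Z : TermCat Sg} (t : Term Sg [Z.ty] Y.ty) :
    X ◁ ofTerm t = ofTerm (X := X ⊗ Z) (Y := X ⊗ Y)
      (.pair (pr₁ _ _) (t.subst (Subst.one (pr₂ X.ty Z.ty)))) := by
  apply CartesianMonoidalCategory.hom_ext
  · rw [whiskerLeft_fst]; exact (ofTerm_sound (.fst_pair _ _)).symm
  · rw [whiskerLeft_snd]; exact (ofTerm_sound (.snd_pair _ _)).symm

/-- The term model. -/
noncomputable def termModel (Sg : Signature.{u}) : QLHyperdoctrine.{u, u, u} (TermCat Sg) where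
  P := lindPresheaf Sg
  all X Y := Lind.all X.ty Y.ty
  all_adj X Y b a := Lind.subst_le_iff_le_all X.ty Y.ty b a
  all_beckChevalley X Y Z f a := by
    obtain ⟨t, rfl⟩ := TermCat.ofTerm_surjective f
    rw [TermCat.whiskerLeft_ofTerm]
    exact Lind.all_beckChevalley X.ty t a
  ex X Y := Lind.ex X.ty Y.ty
  ex_adj X Y a b := Lind.ex_le_iff_le_subst X.ty Y.ty a b
  ex_beckChevalley X Y Z f a := by
    obtain ⟨t, rfl⟩ := TermCat.ofTerm_surjective f
    rw [TermCat.whiskerLeft_ofTerm]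
    exact Lind.ex_beckChevalley X.ty t a

/-- The type of tuples interpreting a context. -/
@[reducible] def ctxTy {S : Type u} : List (Ty S) → Ty S
  | [] => .unit
  | σ :: Φ => .prod σ (ctxTy Φ)

/-- The variables of a context as projections from the type of tuples. -/
def proj : (Φ : Ctx Sg) → Subst Φ [ctxTy Φ]
  | _ :: _, _, .zero => TermCat.pr₁ _ _
  | _ :: Φ, _, .succ y => (proj Φ _ y).subst (Subst.one (TermCat.pr₂ _ _))

/-- The tuple of the terms of a substitution. -/
def tupleTerm {Φ : Ctx Sg} : (Ψ : Ctx Sg) → Subst Ψ Φ → Term Sg Φ (ctxTy Ψ)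
  | [], _ => .star
  | _ :: Ψ, s => .pair (s _ .zero) (tupleTerm Ψ fun _ y => s _ y.succ)

theorem proj_tupleTerm {Φ Ψ : Ctx Sg} (s : Subst Ψ Φ) (τ : Ty Sg.Srt) (y : Var Ψ τ) :
    TermEq ((proj Ψ).comp (Subst.one (tupleTerm Ψ s)) τ y) (s τ y) := by
  induction y with
  | zero => exact .fst_pair _ _
  | succ y ih =>
    refine .trans ?_ (ih fun _ y => s _ y.succ)
    change TermEq ((Term.subst _ _).subst _) _
    rw [Term.subst_subst, Subst.one_comp]
    exact TermEq.subst_congr _ (TermEq.one (.snd_pair _ _))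

/-! ### The generic interpretation -/

/-- Basic types as objects of the base category. -/
def TermCat.base (s : Sg.Srt) : TermCat Sg := ⟨.base s⟩

theorem evalTy_base (σ : Ty Sg.Srt) : evalTy (TermCat.base (Sg := Sg)) σ = ⟨σ⟩ := by
  induction σ with
  | base s => rfl
  | unit => rfl
  | prod σ τ ihσ ihτ =>
    change evalTy _ σ ⊗ evalTy _ τ = _
    rw [ihσ, ihτ]
    rfl

theorem evalCtx_base (Φ : Ctx Sg) : evalCtx (TermCat.base (Sg := Sg)) Φ = ⟨ctxTy Φ⟩ := by
  induction Φ with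
  | nil => rfl
  | cons σ Φ ih =>
    change evalTy _ σ ⊗ evalCtx _ Φ = _
    rw [ih, evalTy_base]
    rfl

/-- The generic interpretation in the term model. A type `σ` is interpreted by an object that
equals `σ` only propositionally, whence the casts. -/
noncomputable def genericInterp (Sg : Signature.{u}) : Interp Sg (termModel Sg) where
  srt := TermCat.base
  fn f := cast (by rw [evalTy_base, evalCtx_base])
    (TermCat.ofTerm (X := ⟨ctxTy (Sg.dom f)⟩) (Y := ⟨Sg.cod f⟩) (.app f (proj (Sg.dom f))))
  rel R := cast (β := (termModel Sg).P.obj (.op (evalCtx TermCat.base (Sg.ar R))))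
    (by rw [evalCtx_base]; rfl) (Lind.mk (.atom R (proj (Sg.ar R))))

section HEq

variable {C : Type v} [Category.{w} C] [CartesianMonoidalCategory C]
  (H : QLHyperdoctrine.{v, w, x} C) {X X' Y Y' Z Z' : C}

theorem lift_heq_lift (hX : X = X') (hY : Y = Y') (hZ : Z = Z') {f : X ⟶ Y} {f' : X' ⟶ Y'}
    {g : X ⟶ Z} {g' : X' ⟶ Z'} (hf : f ≍ f') (hg : g ≍ g') : lift f g ≍ lift f' g' := by
  subst hX hY hZ hf hg
  rfl

theorem fst_heq_fst (hX : X = X') (hY : Y = Y') : fst X Y ≍ fst X' Y' := by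
  subst hX hY
  rfl

theorem snd_heq_snd (hX : X = X') (hY : Y = Y') : snd X Y ≍ snd X' Y' := by
  subst hX hY
  rfl

theorem toUnit_heq_toUnit (hX : X = X') : toUnit X ≍ toUnit X' := by
  subst hX
  rfl

theorem map_heq_map (hX : X = X') (hY : Y = Y') {f : X ⟶ Y} {f' : X' ⟶ Y'} (hf : f ≍ f')
    {a : H.P.obj (.op Y)} {a' : H.P.obj (.op Y')} (ha : a ≍ a') :
    H.P.map f.op a ≍ H.P.map f'.op a' := by
  subst hX hY hf ha
  rfl

theorem inf_heq_inf (hX : X = X') {a b : H.P.obj (.op X)} {a' b' : H.P.obj (.op X')}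
    (ha : a ≍ a') (hb : b ≍ b') : a ⊓ b ≍ a' ⊓ b' := by
  subst hX ha hb
  rfl

theorem compl_heq_compl (hX : X = X') {a : H.P.obj (.op X)} {a' : H.P.obj (.op X')}
    (ha : a ≍ a') : aᶜ ≍ a'ᶜ := by
  subst hX ha
  rfl

theorem top_heq_top (hX : X = X') : (⊤ : H.P.obj (.op X)) ≍ (⊤ : H.P.obj (.op X')) := by
  subst hX
  rfl

theorem all_heq_all (hX : X = X') (hY : Y = Y') {a : H.P.obj (.op (X ⊗ Y))}
    {a' : H.P.obj (.op (X' ⊗ Y'))} (ha : a ≍ a') : H.all X Y a ≍ H.all X' Y' a' := by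
  subst hX hY ha
  rfl

theorem le_iff_le_of_heq (hX : X = X') {a b : H.P.obj (.op X)} {a' b' : H.P.obj (.op X')}
    (ha : a ≍ a') (hb : b ≍ b') : a ≤ b ↔ a' ≤ b' := by
  subst hX ha hb
  rfl

end HEq

theorem evalVar_base_heq {Φ : Ctx Sg} {σ : Ty Sg.Srt} (y : Var Φ σ) :
    evalVar (TermCat.base (Sg := Sg)) y ≍
      TermCat.ofTerm (X := ⟨ctxTy Φ⟩) (Y := ⟨σ⟩) (proj Φ σ y) := by
  induction y with
  | zero => exact fst_heq_fst (evalTy_base _) (evalCtx_base _)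
  | @succ Φ σ τ y ih =>
    exact heq_comp (evalCtx_base (_ :: _)) (evalCtx_base _) (evalTy_base _)
      (snd_heq_snd (evalTy_base _) (evalCtx_base _)) ih

theorem tuple_base_heq {X : TermCat Sg} {ρ : Ty Sg.Srt} (hX : X = ⟨ρ⟩) {Ψ : Ctx Sg}
    (g : ∀ τ, Var Ψ τ → (X ⟶ evalTy TermCat.base τ)) (s : Subst Ψ [ρ])
    (h : ∀ τ y, g τ y ≍ TermCat.ofTerm (X := ⟨ρ⟩) (Y := ⟨τ⟩) (s τ y)) :
    tuple TermCat.base Ψ g ≍ TermCat.ofTerm (X := ⟨ρ⟩) (Y := ⟨ctxTy Ψ⟩) (tupleTerm Ψ s) := by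
  induction Ψ with
  | nil =>
    subst hX
    exact heq_of_eq (toUnit_unique _ _)
  | cons σ Ψ ih =>
    refine HEq.trans (lift_heq_lift hX (evalTy_base _) (evalCtx_base _) (h _ _)
      (ih _ (fun _ y => s _ y.succ) fun _ _ => h _ _)) ?_
    rw [TermCat.lift_ofTerm_ofTerm]
    rfl

/-- Up to the identification of `σ` with its interpretation, a term in context `Φ` is interpreted
by itself, with its variables read as the components of a tuple. -/
theorem genericInterp_term_heq {Φ : Ctx Sg} {σ : Ty Sg.Srt} (t : Term Sg Φ σ) :
    (genericInterp Sg).term t ≍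
      TermCat.ofTerm (X := ⟨ctxTy Φ⟩) (Y := ⟨σ⟩) (t.subst (proj Φ)) := by
  induction t with
  | var y => exact evalVar_base_heq y
  | app f ts ih =>
    refine HEq.trans (heq_comp (evalCtx_base _) (evalCtx_base _) (evalTy_base _)
      (tuple_base_heq (evalCtx_base _) _ (Subst.comp ts (proj Φ)) fun τ y => ih τ y)
      (cast_heq _ _)) (heq_of_eq ?_)
    exact TermCat.ofTerm_sound (.app f fun τ y => proj_tupleTerm _ τ y)
  | star =>
    exact HEq.trans (toUnit_heq_toUnit (evalCtx_base _)) (heq_of_eq (toUnit_unique _ _))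
  | pair a b iha ihb =>
    refine HEq.trans (lift_heq_lift (evalCtx_base _) (evalTy_base _) (evalTy_base _) iha ihb) ?_
    rw [TermCat.lift_ofTerm_ofTerm]
    rfl
  | fst a ih =>
    exact heq_comp (evalCtx_base _) (evalTy_base (.prod _ _)) (evalTy_base _) ih
      (fst_heq_fst (evalTy_base _) (evalTy_base _))
  | snd a ih =>
    exact heq_comp (evalCtx_base _) (evalTy_base (.prod _ _)) (evalTy_base _) ih
      (snd_heq_snd (evalTy_base _) (evalTy_base _))

theorem genericInterp_atom_heq {Φ : Ctx Sg} (R : Sg.Rel) (ts : Subst (Sg.ar R) Φ) :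
    (genericInterp Sg).formula (.atom R ts) ≍ Lind.mk ((Formula.atom R ts).subst (proj Φ)) := by
  refine HEq.trans (map_heq_map (termModel Sg) (evalCtx_base _) (evalCtx_base _)
      (tuple_base_heq (evalCtx_base _) _ (Subst.comp ts (proj Φ))
        fun τ y => genericInterp_term_heq (ts τ y))
      (cast_heq _ _)) (heq_of_eq ?_)
  exact Lind.mk_subst_congr (proj_tupleTerm (Subst.comp ts (proj Φ)))
    (.atom R fun _ y => .var y)

theorem genericInterp_formula_heq {Φ : Ctx Sg} (A : Formula Sg Φ) :
    (genericInterp Sg).formula A ≍ Lind.mk (A.subst (proj Φ)) := by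
  have hneg : ∀ {Φ : Ctx Sg} (A : Formula Sg Φ),
      (genericInterp Sg).formula A ≍ Lind.mk (A.subst (proj Φ)) →
      (genericInterp Sg).formula A.neg ≍ Lind.mk (A.neg.subst (proj Φ)) := by
    intro Φ A h
    rw [Interp.formula_neg, ← Formula.neg_subst]
    exact compl_heq_compl (termModel Sg) (evalCtx_base Φ) (X' := ⟨ctxTy Φ⟩) h
  have htop : ∀ {Φ : Ctx Sg},
      (genericInterp Sg).formula (Φ := Φ) .top ≍ Lind.mk ((Formula.top).subst (proj Φ)) :=
    fun {Φ} => top_heq_top (termModel Sg) (evalCtx_base Φ)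
  have hand : ∀ {Φ : Ctx Sg} {A B : Formula Sg Φ},
      (genericInterp Sg).formula A ≍ Lind.mk (A.subst (proj Φ)) →
      (genericInterp Sg).formula B ≍ Lind.mk (B.subst (proj Φ)) →
      (genericInterp Sg).formula (.and A B) ≍ Lind.mk ((A.and B).subst (proj Φ)) :=
    fun {Φ A B} hA hB => inf_heq_inf (termModel Sg) (evalCtx_base Φ) (X' := ⟨ctxTy Φ⟩) hA hB
  have hall : ∀ {Φ : Ctx Sg} {σ : Ty Sg.Srt} {A : Formula Sg (σ :: Φ)},
      (genericInterp Sg).formula A ≍ Lind.mk (A.subst (proj (σ :: Φ))) →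
      (genericInterp Sg).formula (.all σ A) ≍ Lind.mk ((A.all σ).subst (proj Φ)) := by
    intro Φ σ A h
    refine HEq.trans (all_heq_all (termModel Sg) (evalTy_base σ) (evalCtx_base Φ)
      (X' := ⟨σ⟩) (Y' := ⟨ctxTy Φ⟩) h) (heq_of_eq ?_)
    have h' : Lind.mk ((A.subst (proj (σ :: Φ))).subst (Subst.pairVars σ [] (ctxTy Φ))) =
        Lind.mk (A.subst ((proj Φ).lift σ)) := by
      rw [Formula.subst_subst]
      refine Lind.mk_subst_congr (fun τ y => ?_) A
      cases y with
      | zero => exact .fst_pair _ _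
      | succ y =>
        change TermEq (((proj Φ τ y).subst _).subst _) ((proj Φ τ y).subst _)
        rw [Term.subst_subst, Subst.one_comp]
        refine TermEq.subst_congr _ fun κ z => ?_
        cases z with
        | zero => exact .snd_pair _ _
        | succ z => cases z
    exact Quotient.sound ⟨(Quotient.exact h').1.all_mono, (Quotient.exact h').2.all_mono⟩
  -- `⊥`, `∨`, `∃` and negative literals are negations of the other formulas.
  induction A with
  | atom R ts => exact genericInterp_atom_heq R ts
  | natom R ts => exact hneg _ (genericInterp_atom_heq R ts)
  | top => exact htop
  | bot => exact hneg _ htop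
  | and A B ihA ihB => exact hand ihA ihB
  | or A B ihA ihB =>
    simpa only [Formula.neg, Formula.neg_neg] using hneg _ (hand (hneg _ ihA) (hneg _ ihB))
  | all σ A ih => exact hall ih
  | ex σ A ih => simpa only [Formula.neg, Formula.neg_neg] using hneg _ (hall (hneg _ ih))

/-- Formulas that are ordered in the generic interpretation are ordered by derivability: the
context `Φ` is a retract of the context with one variable of the type of tuples. -/
theorem derivable_of_genericInterp_le {Φ : Ctx Sg} {A B : Formula Sg Φ}
    (h : (genericInterp Sg).formula A ≤ (genericInterp Sg).formula B) : Derivable [A] [B] := by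
  have h₁ : Derivable [A.subst (proj Φ)] [B.subst (proj Φ)] :=
    (le_iff_le_of_heq (termModel Sg) (evalCtx_base Φ) (X' := ⟨ctxTy Φ⟩)
      (genericInterp_formula_heq A) (genericInterp_formula_heq B)).1 h
  have h₂ := h₁.subst_one (Subst.one (tupleTerm Φ fun _ y => .var y))
  rw [Formula.subst_subst, Formula.subst_subst] at h₂
  have hs := proj_tupleTerm (fun _ (y : Var Φ _) => (Term.var y : Term Sg Φ _))
  have hA := Derivable.subst_conv (fun τ y => (hs τ y).symm) A
  have hB := Derivable.subst_conv hs B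
  rw [Formula.subst_var] at hA hB
  exact (hA.trans h₂).trans hB

theorem Interp.formula_bigAnd {C : Type v} [Category.{w} C] [CartesianMonoidalCategory C]
    {H : QLHyperdoctrine.{v, w, x} C} (I : Interp Sg H) {Φ : Ctx Sg} (Γ : List (Formula Sg Φ)) :
    I.formula (Formula.bigAnd Γ) = I.meet Γ := by
  induction Γ with
  | nil => rfl
  | cons A Γ ih => rw [meet_cons, ← ih]; rfl

theorem Interp.formula_bigOr {C : Type v} [Category.{w} C] [CartesianMonoidalCategory C]
    {H : QLHyperdoctrine.{v, w, x} C} (I : Interp Sg H) {Φ : Ctx Sg} (Δ : List (Formula Sg Φ)) :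
    I.formula (Formula.bigOr Δ) = I.join Δ := by
  induction Δ with
  | nil => rfl
  | cons A Δ ih => rw [join_cons, ← ih]; rfl

theorem derivable_of_genericInterp_valid {Φ : Ctx Sg} {Γ Δ : List (Formula Sg Φ)}
    (h : (genericInterp Sg).Valid Γ Δ) : Derivable Γ Δ := by
  refine .of_bigAnd_bigOr (derivable_of_genericInterp_le ?_)
  rw [Interp.formula_bigAnd, Interp.formula_bigOr]
  exact h

end TFSq

theorem mainTheorem2 (Sg : TFSq.Signature.{u}) (Φ : TFSq.Ctx Sg)
    (Γ Δ : List (TFSq.Formula Sg Φ)) :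
    -- soundness
    (TFSq.Derivable Γ Δ →
      ∀ (C : Type v) [Category.{w} C] [CartesianMonoidalCategory C]
        (H : QLHyperdoctrine.{v, w, x} C) (I : TFSq.Interp Sg H), I.Valid Γ Δ) ∧
    -- completeness
    ((∀ (C : Type u) [Category.{u} C] [CartesianMonoidalCategory C]
        (H : QLHyperdoctrine.{u, u, u} C) (I : TFSq.Interp Sg H), I.Valid Γ Δ) →
      TFSq.Derivable Γ Δ) := by
  exact ⟨fun h C _ _ H I => I.valid_of_derivable h, fun h =>
    TFSq.derivable_of_genericInterp_valid (h (TFSq.TermCat Sg) (TFSq.termModel Sg) _)⟩
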